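/- **Setting.** There are $N\ge 1$ agents and $M\ge 1$ divisible resources. A request profile $y=(v,x,b)$ consists of values $v$, demands $x\in\mathbb R^{N\times M}$ and budgets $b\in\mathbb R^M$, and ranges over $Y=\mathcal V\times\mathcal D\times\mathcal B$, where $v_{i,m}\ge 0$ and $\sum_m v_{i,m}\le 1$ on $\mathcal V$, $0\le x_{i,m}\le\bar x$ on $\mathcal D$ and $0\le b_m\le\bar b$ on $\mathcal B$. The utility of agent $i$ for an allocation $a\in\mathbb R^{N\times M}$ is $u_i(a,v,x)=\sum_m v_{i,m}\min\{a_{i,m},x_{i,m}\}$. Fix agent weights $0\le w_i\le\bar w$. For a mechanism $f:Y\to\mathbb R^{N\times M}$ put $$\mathrm{logNSW}(f,y)=\sum_i w_i\log u_i(f(y),v,x),\qquad \mathrm{expl}_i(f,y)=\sup_{v_i',x_i'}u_i\big(f((v_i',v_{-i}),(x_i',x_{-i}),b),v,x\big)-u_i(f(y),v,x),$$ the supremum being over misreports with $(v_i',v_{-i})\in\mathcal V$, $(x_i',x_{-i})\in\mathcal D$. **Mechanisms.** Let $R,K\ge 1$. A feed-forward network with input $y\in\mathbb R^{2NM+M}$,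 $R$ hidden layers of $K$ nodes with activation $\tanh$, affine layers, and parameter vector $\omega\in\mathbb R^d$ (all weights and biases, $d$ being their number) is followed by an output layer, which is one of the following. * *ExS-Net*: the network has $(N+1)M$ outputs $s_{k,m}$, and $f^\omega_{i,m}(y)=\min\{\tilde a_{i,m}b_m,x_{i,m}\}$ for $i\le N$, where $\tilde a_{i,m}=e^{s_{i,m}}/\sum_{k=1}^{N+1}e^{s_{k,m}}$. * *ExPF-Net* (strongly convex regularization): the network has $NM$ outputs $z_{i,m}$, and $f^\omega(y)$ is the minimizer of $-\sum_i w_i\log(a_i^\top v_i)+\zeta\|a\|_2^2+\langle a,z\rangle$ over $\{a: 0\le a\le x,\ \sum_i a_{i,m}\le b_m\ \forall m\}$, where $\zeta\ge\zeta_0>0$. Let $\Omega$ be such that $L\,\Omega\max\{K,MN\}\ge 2$, and assume that for some $\psi>0$ we have $\frac1\psi\le u_i(f^\omega(y),v,x)\le\psi$ for all $i$, all $y\in Y$ and all $\omega$ with $\|\omega\|_1\le\Omega$. Let $F$ be a probability distribution on $Y$ and $y^{(1)},\dots,y^{(L)}$ be i.i.d. samples from $F$. **Theorem.** For either architecture there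 is a constant $C>0$ depending only on $\bar x,\bar b,\bar w,\zeta_0$ such that for every $\delta\in(0,1)$: (i) with probability at least $1-\delta$, for all $\omega$ with $\|\omega\|_1\le\Omega$ simultaneously, $$\Big|\mathbb E_{y\sim F}[-\mathrm{logNSW}(f^\omega,y)]-\frac1L\sum_{l=1}^L\big(-\mathrm{logNSW}(f^\omega,y^{(l)})\big)\Big|\le C\,N(1+\log\psi)\left(\sqrt{\frac{Rd\log(\psi L\Omega\max\{K,MN\})}{L}}+\sqrt{\frac{\log(1/\delta)}{L}}\right);$$ (ii) with probability at least $1-\delta$, for all $\omega$ with $\|\omega\|_1\le\Omega$ and all agents $i$ simultaneously, $$\Big|\mathbb E_{y\sim F}[\mathrm{expl}_i(f^\omega,y)]-\frac1L\sum_{l=1}^L\mathrm{expl}_i(f^\omega,y^{(l)})\Big|\le C\left(\sqrt{\frac{Rd\log(LN\Omega\max\{K,MN\})}{L}}+\sqrt{\frac{\log(1/\delta)}{L}}\right).$$ For fixed $\psi$, $\delta$, and $N$ outside the root, these are the rates $O(\sqrt{Rd\log(L\Omega\max\{K,MN\})/L})$ and $O(\sqrt{Rd\log(LN\Omega\max\{K,MN\})/L})$.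 -/

import Mathlib

open MeasureTheory

noncomputable section

/-- Real matrices indexed by agents `i < N` and resources `m < M`: values `v`, demands `x` and
allocations `a` are all of this form. -/
abbrev AgentRes (N M : ℕ) : Type := Fin N → Fin M → ℝ

/-- A request profile `y = (v, x, b)`: values, demands, budgets. -/
abbrev Profile (N M : ℕ) : Type := AgentRes N M × AgentRes N M × (Fin M → ℝ)

/-! ### Utility, Nash social welfare, exploitability -/

/-- `u_i(a, v, x) = ∑ₘ v_{i,m} min {a_{i,m}, x_{i,m}}`. -/
def utility {N M : ℕ} (a v x : AgentRes N M) (i : Fin N) : ℝ :=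
  ∑ m, v i m * min (a i m) (x i m)

/-- The logarithmic Nash social welfare `wᵀ log u(f(v,x,b), v, x)`. -/
def logNSW {N M : ℕ} (w : Fin N → ℝ) (f : Profile N M → AgentRes N M) (y : Profile N M) : ℝ :=
  ∑ i, w i * Real.log (utility (f y) y.1 y.2.1 i)

/-- The report `((v_i', v_{-i}), (x_i', x_{-i}), b)`, in which only agent `i` deviates. -/
def misreport {N M : ℕ} (y : Profile N M) (i : Fin N) (r : (Fin M → ℝ) × (Fin M → ℝ)) :
    Profile N M :=
  (Function.update y.1 i r.1, Function.update y.2.1 i r.2, y.2.2)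

/-- Exploitability of `f` at agent `i`: the largest gain in true utility from a unilateral
misreport which keeps the profile in the space `V × D` of values and demands. -/
def exploitability {N M : ℕ} (V D : Set (AgentRes N M)) (f : Profile N M → AgentRes N M)
    (i : Fin N) (y : Profile N M) : ℝ :=
  sSup ((fun r => utility (f (misreport y i r)) y.1 y.2.1 i) ''
      {r | (misreport y i r).1 ∈ V ∧ (misreport y i r).2.1 ∈ D})
    - utility (f y) y.1 y.2.1 i

/-! ### Feed-forward networks with `tanh` hidden layers -/

/-- The affine map `z ↦ W z + c`. The entries of a layer are indexed by `o × Option ι`: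
`(k, some j)` is the weight `W k j`, and `(k, none)` is the bias `c k`. -/
def affineLayer {ι o : Type} [Fintype ι] (W : o × Option ι → ℝ) (z : ι → ℝ) (k : o) : ℝ :=
  W (k, none) + ∑ j, W (k, some j) * z j

/-- A hidden layer, `z ↦ tanh (W z + c)`. -/
def tanhLayer {ι o : Type} [Fintype ι] (W : o × Option ι → ℝ) (z : ι → ℝ) (k : o) : ℝ :=
  Real.tanh (affineLayer W z k)

/-- Composition of `n` further hidden layers of `K` nodes. -/
def tanhLayers {K : ℕ} :
    (n : ℕ) → (Fin n → Fin K × Option (Fin K) → ℝ) → (Fin K → ℝ) → (Fin K → ℝ)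
  | 0, _, h => h
  | n + 1, W, h => tanhLayers n (fun r => W r.succ) (tanhLayer (W 0) h)

/-- Index set of all the parameters of a network with inputs `ι`, outputs `o` and `R ≥ 1` hidden
layers of `K` nodes: the layer from the inputs to the first hidden layer, the `R - 1` layers between
consecutive hidden layers, and the layer from the last hidden layer to the outputs. -/
abbrev ParamIdx (R K : ℕ) (ι o : Type) : Type :=
  (Fin K × Option ι) ⊕ (Fin (R - 1) × (Fin K × Option (Fin K))) ⊕ (o × Option (Fin K))

/-- The network with parameter vector `ω`, up to (not including) the output activation. -/
def network {R K : ℕ} {ι o : Type} [Fintype ι] (ω : ParamIdx R K ι o → ℝ) (z : ι → ℝ) : o → ℝ :=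
  affineLayer (fun p => ω (Sum.inr (Sum.inr p)))
    (tanhLayers (R - 1) (fun r p => ω (Sum.inr (Sum.inl (r, p))))
      (tanhLayer (fun p => ω (Sum.inl p)) z))

/-- `‖ω‖₁`. -/
def l1norm {P : Type} [Fintype P] (ω : P → ℝ) : ℝ := ∑ p, |ω p|

/-- Index set of the `2NM + M` network inputs. -/
abbrev InputIdx (N M : ℕ) : Type := (Fin N × Fin M) ⊕ (Fin N × Fin M) ⊕ Fin M

/-- A profile as the vector of network inputs. -/
def flatten {N M : ℕ} (y : Profile N M) : InputIdx N M → ℝ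
  | Sum.inl p => y.1 p.1 p.2
  | Sum.inr (Sum.inl p) => y.2.1 p.1 p.2
  | Sum.inr (Sum.inr m) => y.2.2 m

/-! ### Output layers -/

/-- Output layer of ExS-Net. For each resource, the softmax over the `N` agents and one artificial
agent (the last one, whose share is discarded) gives fractions `ã_{i,m}`; then
`a_{i,m} = min {ã_{i,m} b_m, x_{i,m}}`. -/
def exSOutput {N M : ℕ} (s : Fin (N + 1) × Fin M → ℝ) (y : Profile N M) : AgentRes N M :=
  fun i m =>
    min (Real.exp (s (i.castSucc, m)) / (∑ k, Real.exp (s (k, m))) * y.2.2 m) (y.2.1 i m)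

/-- Allocations with `0 ≤ a ≤ x` and `∑ᵢ a_{i,m} ≤ b_m`. -/
def feasible {N M : ℕ} (y : Profile N M) : Set (AgentRes N M) :=
  {a | (∀ i m, 0 ≤ a i m ∧ a i m ≤ y.2.1 i m) ∧ ∀ m, ∑ i, a i m ≤ y.2.2 m}

/-- The feasible allocations at which the proportional-fairness objective is finite
(`-w_i log 0 = +∞` for `w_i > 0`). -/
def pfDomain {N M : ℕ} (w : Fin N → ℝ) (y : Profile N M) : Set (AgentRes N M) :=
  {a | a ∈ feasible y ∧ ∀ i, 0 < w i → 0 < ∑ m, a i m * y.1 i m}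

/-- The regularized objective `-∑ᵢ w_i log(a_iᵀ v_i) + ζ ‖a‖² + ⟨a, z⟩`. -/
def pfObjective {N M : ℕ} (w : Fin N → ℝ) (ζ : ℝ) (y : Profile N M) (z : Fin N × Fin M → ℝ)
    (a : AgentRes N M) : ℝ :=
  -(∑ i, w i * Real.log (∑ m, a i m * y.1 i m)) + ζ * (∑ i, ∑ m, a i m ^ 2)
    + ∑ i, ∑ m, a i m * z (i, m)

open scoped Classical in
/-- Output layer of ExPF-Net: the minimizer of the regularized objective over the feasible
allocations (unique for `ζ > 0`). The value is `0` if there is no feasible allocation with a finite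
objective. -/
def exPFOutput {N M : ℕ} (w : Fin N → ℝ) (ζ : ℝ) (z : Fin N × Fin M → ℝ) (y : Profile N M) :
    AgentRes N M :=
  if h : ∃ a, a ∈ pfDomain w y ∧ IsMinOn (pfObjective w ζ y z) (pfDomain w y) a
  then h.choose else 0

/-! ### The two families of mechanisms -/

/-- The two architectures. -/
inductive Arch : Type
  | exS : Arch
  | exPF : Arch

/-- Index set of the network outputs: `(N + 1) M` of them in ExS-Net, `N M` in ExPF-Net. -/
def OutputIdx (N M : ℕ) : Arch → Type
  | Arch.exS => Fin (N + 1) × Fin M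
  | Arch.exPF => Fin N × Fin M

instance OutputIdx.instFintype (N M : ℕ) : (A : Arch) → Fintype (OutputIdx N M A)
  | Arch.exS => inferInstanceAs (Fintype (Fin (N + 1) × Fin M))
  | Arch.exPF => inferInstanceAs (Fintype (Fin N × Fin M))

/-- Index set of all the parameters of the mechanism. -/
abbrev MechParam (A : Arch) (R K N M : ℕ) : Type := ParamIdx R K (InputIdx N M) (OutputIdx N M A)

/-- The number `d` of parameters. -/
def numParams (A : Arch) (R K N M : ℕ) : ℕ := Fintype.card (MechParam A R K N M)

/-- The mechanism `f^ω`: the network followed by the output layer of the architecture. -/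
def mechanism : (A : Arch) → {R K N M : ℕ} → (w : Fin N → ℝ) → (ζ : ℝ) →
    (ω : MechParam A R K N M → ℝ) → Profile N M → AgentRes N M
  | Arch.exS, _, _, _, _, _, _, ω, y => exSOutput (network ω (flatten y)) y
  | Arch.exPF, _, _, _, _, w, ζ, ω, y => exPFOutput w ζ (network ω (flatten y)) y

/-- The generalization error of `h` on the sample `S`: the distance between the expectation of `h`
under `F` and its empirical mean. -/
def genError {Y : Type} [MeasurableSpace Y] (F : Measure Y) {L : ℕ} (S : Fin L → Y)
    (h : Y → ℝ) : ℝ :=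
  |(∫ y, h y ∂F) - (1 / (L : ℝ)) * ∑ l, h (S l)|

end

/-! The proof is a covering argument. For one fixed parameter vector, Hoeffding's inequality
controls the generalization error. A union bound over a finite `r`-net of the ℓ¹-ball of radius `Ω`,
of size at most `(1 + 2Ω/r)^d`, handles all net points and agents at once. Lipschitz dependence on
`ω`, uniform over the profile space, transfers the bound from the net to the whole ball.

The Lipschitz constant is a product of factors free of `N` and `M`, times the loss-dependent one.
Measured in ℓ¹, the network is `H (1 + Ω)^R`-Lipschitz in its parameters (`sum_abs_network_sub_le`),
because hidden activations stay in `[-1, 1]`. The softmax layer is `2 bbar`-Lipschitz; the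
optimization layer is `1/ζ`-Lipschitz by strong convexity, whatever the logarithmic terms do
(`abs_sub_le_of_isMinOn_pfObjective`). Welfare then costs a factor `N wbar ψ`, since utilities stay
above `1/ψ`, and exploitability a factor `2`, since a supremum is 1-Lipschitz.

The mesh `r` is of order `1/L` divided by `(1 + Ω)^R`, and by `ψ` as well for welfare. The
discretization error is then `O(1/L)`, and the log of the net size is at most `6 R d log Q`, where
`Q` is the argument of the logarithm in the rate. This is the origin of the factor `R d` under the
root. -/

/-! ### Covering numbers of norm balls. -/

/-- Volume comparison: the balls of radius `r/2` around the points are disjoint and lie in the ball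
of radius `Ω + r/2`. -/
theorem card_le_of_separated_of_norm_le {E : Type*} [NormedAddCommGroup E] [NormedSpace ℝ E]
    [FiniteDimensional ℝ E] {Ω r : ℝ} (hΩ : 0 ≤ Ω) (hr : 0 < r) (s : Finset E)
    (hs : ∀ c ∈ s, ‖c‖ ≤ Ω) (h : ∀ c ∈ s, ∀ d ∈ s, c ≠ d → r ≤ ‖c - d‖) :
    (s.card : ℝ) ≤ (1 + 2 * Ω / r) ^ Module.finrank ℝ E := by
  borelize E
  let μ : Measure E := Measure.addHaar
  set δ : ℝ := r / 2 with hδ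
  set ρ : ℝ := Ω + r / 2 with hρ
  have δpos : 0 < δ := by positivity
  have ρpos : 0 < ρ := by positivity
  set A := ⋃ c ∈ s, Metric.ball (c : E) δ with hA
  have D : Set.Pairwise (s : Set E) (Function.onFun Disjoint fun c => Metric.ball (c : E) δ) := by
    rintro c hc d hd hcd
    apply Metric.ball_disjoint_ball
    rw [dist_eq_norm]
    linarith [h c hc d hd hcd]
  have A_subset : A ⊆ Metric.ball (0 : E) ρ := by
    refine Set.iUnion₂_subset fun x hx => ?_
    apply Metric.ball_subset_ball'
    rw [dist_zero_right]
    linarith [hs x hx]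
  have I : (s.card : ENNReal) * ENNReal.ofReal (δ ^ Module.finrank ℝ E) * μ (Metric.ball 0 1) ≤
      ENNReal.ofReal (ρ ^ Module.finrank ℝ E) * μ (Metric.ball 0 1) :=
    calc
      (s.card : ENNReal) * ENNReal.ofReal (δ ^ Module.finrank ℝ E) * μ (Metric.ball 0 1) = μ A := by
        rw [hA, measure_biUnion_finset D fun c _ => measurableSet_ball]
        simp only [μ.addHaar_ball_of_pos _ δpos]
        simp only [Finset.sum_const, nsmul_eq_mul, mul_assoc]
      _ ≤ μ (Metric.ball (0 : E) ρ) := measure_mono A_subset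
      _ = ENNReal.ofReal (ρ ^ Module.finrank ℝ E) * μ (Metric.ball 0 1) := by
        simp only [μ.addHaar_ball_of_pos _ ρpos]
  have J : (s.card : ENNReal) * ENNReal.ofReal (δ ^ Module.finrank ℝ E) ≤
      ENNReal.ofReal (ρ ^ Module.finrank ℝ E) :=
    (ENNReal.mul_le_mul_iff_left (Metric.measure_ball_pos _ _ zero_lt_one).ne'
      measure_ball_lt_top.ne).1 I
  have K := ENNReal.toReal_le_of_le_ofReal (pow_nonneg ρpos.le _) J
  rw [ENNReal.toReal_mul, ENNReal.toReal_ofReal (by positivity), ENNReal.toReal_natCast,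
    ← le_div_iff₀ (by positivity), ← div_pow] at K
  have e : ρ / δ = 1 + 2 * Ω / r := by
    rw [hδ, hρ]
    field_simp
    ring
  rwa [e] at K

/-- A separated set of maximal cardinality is a net, since an uncovered point could be adjoined to
it. The packing bound ensures that a maximum exists. -/
theorem exists_net_closedBall (E : Type*) [NormedAddCommGroup E] [NormedSpace ℝ E]
    [FiniteDimensional ℝ E] {Ω r : ℝ} (hΩ : 0 ≤ Ω) (hr : 0 < r) :
    ∃ s : Finset E, (∀ c ∈ s, ‖c‖ ≤ Ω) ∧ (∀ x : E, ‖x‖ ≤ Ω → ∃ c ∈ s, ‖x - c‖ ≤ r) ∧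
      (s.card : ℝ) ≤ (1 + 2 * Ω / r) ^ Module.finrank ℝ E := by
  classical
  let T : Set ℕ := {n | ∃ s : Finset E, s.card = n ∧ (∀ c ∈ s, ‖c‖ ≤ Ω) ∧
    ∀ c ∈ s, ∀ d ∈ s, c ≠ d → r ≤ ‖c - d‖}
  have hT : BddAbove T := by
    refine ⟨⌊(1 + 2 * Ω / r) ^ Module.finrank ℝ E⌋₊, ?_⟩
    rintro n ⟨s, rfl, h1, h2⟩
    exact Nat.le_floor (card_le_of_separated_of_norm_le hΩ hr s h1 h2)
  obtain ⟨s, hs, h1, h2⟩ := Nat.sSup_mem (s := T) ⟨0, ∅, by simp⟩ hT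
  refine ⟨s, h1, fun x hx => ?_, card_le_of_separated_of_norm_le hΩ hr s h1 h2⟩
  by_contra! hcon
  have hxs : x ∉ s := fun hxs => by
    have := hcon x hxs
    simp at this
    linarith
  have : (insert x s).card ∈ T := by
    refine ⟨insert x s, rfl, ?_, ?_⟩
    · simpa using ⟨hx, h1⟩
    · intro c hc d hd hcd
      rcases Finset.mem_insert.1 hc with rfl | hc' <;> rcases Finset.mem_insert.1 hd with rfl | hd'
      · exact absurd rfl hcd
      · exact (hcon d hd').le
      · rw [norm_sub_rev]
        exact (hcon c hc').le
      · exact h2 c hc' d hd' hcd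
  have := le_csSup hT this
  rw [Finset.card_insert_of_notMem hxs] at this
  omega

theorem exists_l1norm_net (P : Type) [Fintype P] {Ω r : ℝ} (hΩ : 0 ≤ Ω) (hr : 0 < r) :
    ∃ s : Finset (P → ℝ), (∀ c ∈ s, l1norm c ≤ Ω) ∧
      (∀ ω : P → ℝ, l1norm ω ≤ Ω → ∃ c ∈ s, l1norm (ω - c) ≤ r) ∧
      (s.card : ℝ) ≤ (1 + 2 * Ω / r) ^ Fintype.card P := by
  classical
  -- The plain function space carries the sup norm, so the net is built in `PiLp 1` and carried
  -- back.
  have key : ∀ x : PiLp 1 (fun _ : P => ℝ), ‖x‖ = l1norm (WithLp.ofLp x) := fun x => by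
    simp [PiLp.norm_eq_of_L1, l1norm]
  obtain ⟨s, h1, h2, h3⟩ := exists_net_closedBall (PiLp 1 (fun _ : P => ℝ)) hΩ hr
  refine ⟨s.image WithLp.ofLp, ?_, ?_, ?_⟩
  · intro c hc
    obtain ⟨x, hx, rfl⟩ := Finset.mem_image.1 hc
    rw [← key]
    exact h1 x hx
  · intro ω hω
    obtain ⟨c, hc, hcr⟩ := h2 (WithLp.toLp 1 ω) (by rw [key]; exact hω)
    refine ⟨_, Finset.mem_image_of_mem _ hc, ?_⟩
    rw [key] at hcr
    exact hcr
  · refine le_trans (by exact_mod_cast Finset.card_image_le) (h3.trans_eq ?_)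
    congr 1
    exact (LinearEquiv.finrank_eq (WithLp.linearEquiv 1 ℝ (P → ℝ))).trans
      (Module.finrank_fintype_fun_eq_card ℝ)

/-! ### Concentration for one function and for a Lipschitz family. -/

/-- Hoeffding's inequality: each centred term is sub-Gaussian with parameter `((b - a)/2)^2`, and
these parameters add over independent coordinates. -/
theorem measure_pi_le_sum_sub_integral_le {Y : Type} [MeasurableSpace Y] (F : Measure Y)
    [IsProbabilityMeasure F] {L : ℕ} (hL : 0 < L) {h : Y → ℝ} (hm : AEStronglyMeasurable h F)
    {a b : ℝ} (hab : a < b) (hb : ∀ᵐ y ∂F, h y ∈ Set.Icc a b) {t : ℝ} (ht : 0 ≤ t) :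
    Measure.pi (fun _ : Fin L => F) {S | L * t ≤ ∑ l, (h (S l) - ∫ y, h y ∂F)} ≤
      ENNReal.ofReal (Real.exp (-(2 * L * t ^ 2 / (b - a) ^ 2))) := by
  have hLr : (0 : ℝ) < L := by exact_mod_cast hL
  have hba : 0 < b - a := sub_pos.2 hab
  have hsub : ∀ l : Fin L, ProbabilityTheory.HasSubgaussianMGF
      (fun S : Fin L → Y => h (S l) - ∫ y, h y ∂F) ((‖b - a‖₊ / 2) ^ 2)
      (Measure.pi (fun _ : Fin L => F)) := fun l => by
    have hq := Measure.quasiMeasurePreserving_eval (fun _ : Fin L => F) l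
    have := ProbabilityTheory.hasSubgaussianMGF_of_mem_Icc
      (hm.aemeasurable.comp_quasiMeasurePreserving hq) (hq.ae hb)
    have e : ∫ S : Fin L → Y, h (S l) ∂(Measure.pi (fun _ : Fin L => F)) = ∫ y, h y ∂F :=
      integral_comp_eval (μ := fun _ : Fin L => F) (i := l) hm
    simp only [Function.comp_def, Function.eval] at this
    rwa [e] at this
  have hind := ProbabilityTheory.iIndepFun_pi (ι := Fin L) (μ := fun _ => F)
    (X := fun _ y => h y - ∫ y, h y ∂F) (fun _ => hm.aemeasurable.sub_const _)
  have := ProbabilityTheory.HasSubgaussianMGF.measure_sum_ge_le_of_iIndepFun hind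
    (s := Finset.univ) (fun l _ => hsub l) (ε := L * t) (by positivity)
  rw [← ofReal_measureReal]
  refine ENNReal.ofReal_le_ofReal (this.trans_eq ?_)
  congr 1
  simp only [Finset.sum_const, Finset.card_univ, Fintype.card_fin, nsmul_eq_mul, NNReal.coe_mul,
    NNReal.coe_natCast, NNReal.coe_pow, NNReal.coe_div, coe_nnnorm, Real.norm_eq_abs,
    abs_of_pos hba, NNReal.coe_ofNat]
  field_simp

theorem measure_pi_lt_genError_le {Y : Type} [MeasurableSpace Y] (F : Measure Y)
    [IsProbabilityMeasure F] {L : ℕ} (hL : 0 < L) {h : Y → ℝ} (hm : AEStronglyMeasurable h F)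
    {a b : ℝ} (hab : a < b) (hb : ∀ᵐ y ∂F, h y ∈ Set.Icc a b) {t : ℝ} (ht : 0 ≤ t) :
    Measure.pi (fun _ : Fin L => F) {S | t < genError F S h} ≤
      ENNReal.ofReal (2 * Real.exp (-(2 * L * t ^ 2 / (b - a) ^ 2))) := by
  have hLr : (0 : ℝ) < L := by exact_mod_cast hL
  have h1 := measure_pi_le_sum_sub_integral_le F hL hm hab hb ht
  have h2 := measure_pi_le_sum_sub_integral_le F hL hm.neg (neg_lt_neg hab)
    (hb.mono fun y hy => (⟨neg_le_neg hy.2, neg_le_neg hy.1⟩ : -h y ∈ Set.Icc (-b) (-a))) ht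
  rw [show -a - -b = b - a by ring] at h2
  rw [two_mul, ENNReal.ofReal_add (by positivity) (by positivity)]
  refine le_trans (measure_mono ?_) ((measure_union_le _ _).trans (add_le_add h1 h2))
  intro S hS
  simp only [Set.mem_ofPred_eq, Set.mem_union, genError, Pi.neg_apply, integral_neg,
    Finset.sum_sub_distrib, Finset.sum_neg_distrib, Finset.sum_const, Finset.card_univ,
    Fintype.card_fin, nsmul_eq_mul] at hS ⊢
  set I := ∫ y, h y ∂F
  set T := ∑ l, h (S l)
  have hT : 1 / (L : ℝ) * T * L = T := by field_simp
  rcases lt_abs.1 hS with hS | hS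
  · right
    nlinarith
  · left
    nlinarith

/-- Moving from `ω` to the nearest net point changes both the expectation and the empirical mean by
at most `Λ r`, hence the slack `2 Λ r`. The bad event, over uncountably many `ω`, need not be
measurable; the estimate uses only monotonicity and subadditivity of the outer measure. -/
theorem measure_pi_uniform_genError_le {P I Y : Type} [Fintype P] [Fintype I] [MeasurableSpace Y]
    (F : Measure Y) [IsProbabilityMeasure F] {L : ℕ} (hL : 0 < L) {Y₀ : Set Y}
    (hY : ∀ᵐ y ∂F, y ∈ Y₀) (h : (P → ℝ) → I → Y → ℝ) {Ω r Λ a b t : ℝ} (hΩ : 0 ≤ Ω) (hr : 0 < r)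
    (hΛ : 0 ≤ Λ) (hab : a < b) (ht : 0 ≤ t)
    (hm : ∀ ω, l1norm ω ≤ Ω → ∀ i, AEStronglyMeasurable (h ω i) F)
    (hb : ∀ ω, l1norm ω ≤ Ω → ∀ i, ∀ y ∈ Y₀, h ω i y ∈ Set.Icc a b)
    (hlip : ∀ ω ω', l1norm ω ≤ Ω → l1norm ω' ≤ Ω → ∀ i, ∀ y ∈ Y₀,
      |h ω i y - h ω' i y| ≤ Λ * l1norm (ω - ω')) :
    Measure.pi (fun _ : Fin L => F) {S | ¬ ∀ ω, l1norm ω ≤ Ω → ∀ i,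
        genError F S (h ω i) ≤ t + 2 * (Λ * r)} ≤
      ENNReal.ofReal (2 * Fintype.card I * (1 + 2 * Ω / r) ^ Fintype.card P *
        Real.exp (-(2 * L * t ^ 2 / (b - a) ^ 2))) := by
  classical
  obtain ⟨s, hs1, hs2, hs3⟩ := exists_l1norm_net P hΩ hr
  have hLr : (0 : ℝ) < L := by exact_mod_cast hL
  -- The Lipschitz bound is available only on `Y₀`, so samples that leave `Y₀` are discarded as a
  -- null set.
  have hnull : Measure.pi (fun _ : Fin L => F) {S | ¬ ∀ l, S l ∈ Y₀} = 0 := by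
    have : ∀ᵐ S ∂(Measure.pi (fun _ : Fin L => F)), ∀ l, S l ∈ Y₀ :=
      ae_all_iff.2 fun l => (Measure.quasiMeasurePreserving_eval (fun _ : Fin L => F) l).ae hY
    exact this
  have hint : ∀ ω, l1norm ω ≤ Ω → ∀ i, Integrable (h ω i) F := fun ω hω i =>
    Integrable.of_mem_Icc a b (hm ω hω i).aemeasurable (hY.mono fun y hy => hb ω hω i y hy)
  have hsub : {S : Fin L → Y | ¬ ∀ ω, l1norm ω ≤ Ω → ∀ i,
        genError F S (h ω i) ≤ t + 2 * (Λ * r)} ⊆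
      {S | ¬ ∀ l, S l ∈ Y₀} ∪ ⋃ p ∈ s ×ˢ (Finset.univ : Finset I),
        {S | t < genError F S (h p.1 p.2)} := by
    intro S hS
    by_cases hSY : ∀ l, S l ∈ Y₀
    swap
    · exact Or.inl hSY
    right
    simp only [Set.mem_ofPred_eq, not_forall, not_le] at hS
    obtain ⟨ω, hω, i, hlt⟩ := hS
    obtain ⟨c, hc, hcr⟩ := hs2 ω hω
    refine Set.mem_iUnion₂.2 ⟨(c, i), by simp [hc], ?_⟩
    have hd : ∀ y ∈ Y₀, |h ω i y - h c i y| ≤ Λ * r := fun y hy =>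
      (hlip ω c hω (hs1 c hc) i y hy).trans (mul_le_mul_of_nonneg_left hcr hΛ)
    have e1 : |(∫ y, h ω i y ∂F) - ∫ y, h c i y ∂F| ≤ Λ * r := by
      rw [← integral_sub (hint ω hω i) (hint c (hs1 c hc) i)]
      have := norm_integral_le_of_norm_le_const (μ := F) (f := fun y => h ω i y - h c i y)
        (hY.mono fun y hy => (Real.norm_eq_abs _).trans_le (hd y hy))
      simpa using this
    have e2 : |1 / (L : ℝ) * ∑ l, h ω i (S l) - 1 / (L : ℝ) * ∑ l, h c i (S l)| ≤ Λ * r := by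
      rw [← mul_sub, ← Finset.sum_sub_distrib, abs_mul, abs_of_pos (by positivity)]
      calc 1 / (L : ℝ) * |∑ l, (h ω i (S l) - h c i (S l))|
          ≤ 1 / (L : ℝ) * ∑ l : Fin L, Λ * r := by
            gcongr
            exact (Finset.abs_sum_le_sum_abs _ _).trans
              (Finset.sum_le_sum fun l _ => hd _ (hSY l))
        _ = Λ * r := by
            simp only [Finset.sum_const, Finset.card_univ, Fintype.card_fin, nsmul_eq_mul]
            field_simp
    simp only [Set.mem_ofPred_eq]
    unfold genError at hlt ⊢
    set A := ∫ y, h ω i y ∂F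
    set B := ∫ y, h c i y ∂F
    set A' := 1 / (L : ℝ) * ∑ l, h ω i (S l)
    set B' := 1 / (L : ℝ) * ∑ l, h c i (S l)
    have : |A - A'| ≤ |A - B| + |B - B'| + |A' - B'| := by
      rw [abs_sub_comm A' B']
      calc |A - A'| = |(A - B) + (B - B') + (B' - A')| := by ring_nf
        _ ≤ _ := abs_add_three _ _ _
    linarith
  refine (measure_mono hsub).trans ((measure_union_le _ _).trans ?_)
  rw [hnull, zero_add]
  refine (measure_biUnion_finset_le _ _).trans ((Finset.sum_le_sum fun p hp =>
    measure_pi_lt_genError_le F hL (hm p.1 (hs1 _ (Finset.mem_product.1 hp).1) p.2) hab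
      (hY.mono fun y hy => hb p.1 (hs1 _ (Finset.mem_product.1 hp).1) p.2 y hy) ht).trans ?_)
  rw [Finset.sum_const, nsmul_eq_mul, ← ENNReal.ofReal_natCast,
    ← ENNReal.ofReal_mul (by positivity)]
  apply ENNReal.ofReal_le_ofReal
  rw [Finset.card_product, Finset.card_univ, Nat.cast_mul]
  calc (s.card : ℝ) * Fintype.card I * (2 * Real.exp (-(2 * L * t ^ 2 / (b - a) ^ 2)))
      = 2 * Fintype.card I * s.card * Real.exp (-(2 * L * t ^ 2 / (b - a) ^ 2)) := by ring
    _ ≤ _ := by gcongr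

/-- Turns the tail bound into a rate: the deviation `t` is chosen so that the exponential absorbs
the net size and the number of agents and leaves `δ`. -/
theorem measure_pi_uniform_genError_rate {P I Y : Type} [Fintype P] [Fintype I]
    [MeasurableSpace Y] (F : Measure Y) [IsProbabilityMeasure F] {L : ℕ} (hL : 0 < L) {Y₀ : Set Y}
    (hY : ∀ᵐ y ∂F, y ∈ Y₀) (h : (P → ℝ) → I → Y → ℝ) {Ω r Λ a W A C Q δ : ℝ} {R : ℕ}
    (hΩ : 0 ≤ Ω) (hr : 0 < r) (hΛ : 0 ≤ Λ) (hW : 0 < W) (hA : 0 ≤ A) (hR : 1 ≤ R)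
    (hP : 0 < Fintype.card P) (hI : Fintype.card I ≤ 2 ^ Fintype.card P) (hQ : 2 ≤ Q)
    (hδ : 0 < δ) (hδ1 : δ < 1) (hcov : 1 + 2 * Ω / r ≤ Q ^ (6 * R)) (hΛr : Λ * r ≤ A / L)
    (hC : 2 * W + 4 * A ≤ C)
    (hm : ∀ ω, l1norm ω ≤ Ω → ∀ i, AEStronglyMeasurable (h ω i) F)
    (hb : ∀ ω, l1norm ω ≤ Ω → ∀ i, ∀ y ∈ Y₀, h ω i y ∈ Set.Icc a (a + W))
    (hlip : ∀ ω ω', l1norm ω ≤ Ω → l1norm ω' ≤ Ω → ∀ i, ∀ y ∈ Y₀,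
      |h ω i y - h ω' i y| ≤ Λ * l1norm (ω - ω')) :
    Measure.pi (fun _ : Fin L => F) {S | ¬ ∀ ω, l1norm ω ≤ Ω → ∀ i,
        genError F S (h ω i) ≤ C * (Real.sqrt (R * Fintype.card P * Real.log Q / L)
          + Real.sqrt (Real.log (1 / δ) / L))} ≤ ENNReal.ofReal δ := by
  have hLr : (1 : ℝ) ≤ L := by exact_mod_cast hL
  have hRr : (1 : ℝ) ≤ R := by exact_mod_cast hR
  have hPr : (1 : ℝ) ≤ Fintype.card P := by exact_mod_cast hP
  have hlogQ : 1 / 2 ≤ Real.log Q := by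
    have := Real.log_le_log (by norm_num) hQ
    linarith [Real.log_two_gt_d9]
  have hlogδ : 0 < Real.log (1 / δ) := Real.log_pos (by rw [lt_div_iff₀ hδ]; linarith)
  set d := Fintype.card P with hd
  set X : ℝ := R * d * Real.log Q with hX
  set Z : ℝ := Real.log (1 / δ) with hZ
  have hRd : (1 : ℝ) ≤ R * d := by nlinarith
  have hX2 : 1 / 2 ≤ X := by
    rw [hX]
    nlinarith
  -- The factor `2 W` makes the Hoeffding exponent at least `8 X + Z`: the part `8 X` pays for the
  -- union bound, `Z` for `δ`.
  set t : ℝ := 2 * W * (Real.sqrt (X / L) + Real.sqrt (Z / L)) with ht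
  have ht0 : 0 ≤ t := by positivity
  -- Since `X ≥ 1/2`, the `O(1/L)` discretization error is absorbed by the first root.
  have hL1 : 1 / (L : ℝ) ≤ 2 * Real.sqrt (X / L) := by
    have : Real.sqrt ((1 / (2 * L)) ^ 2) ≤ Real.sqrt (X / L) := by
      apply Real.sqrt_le_sqrt
      rw [div_pow, div_le_div_iff₀ (by positivity) (by positivity)]
      nlinarith
    rw [Real.sqrt_sq (by positivity)] at this
    calc 1 / (L : ℝ) = 2 * (1 / (2 * L)) := by field_simp
      _ ≤ _ := by linarith
  have main := measure_pi_uniform_genError_le F hL hY h hΩ hr hΛ (lt_add_of_pos_right a hW) ht0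
    hm hb hlip
  refine (measure_mono ?_).trans (main.trans (ENNReal.ofReal_le_ofReal ?_))
  · intro S hS hcon
    refine hS fun ω hω i => (hcon ω hω i).trans ?_
    have h0 : 0 ≤ Real.sqrt (Z / L) := Real.sqrt_nonneg _
    have h1 : 0 ≤ Real.sqrt (X / L) := Real.sqrt_nonneg _
    calc t + 2 * (Λ * r) ≤ t + 2 * (A * (2 * Real.sqrt (X / L))) := by
          have : A / L ≤ A * (2 * Real.sqrt (X / L)) := by
            rw [div_eq_mul_one_div]
            exact mul_le_mul_of_nonneg_left hL1 hA
          linarith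
      _ ≤ (2 * W + 4 * A) * (Real.sqrt (X / L) + Real.sqrt (Z / L)) := by
          rw [ht]
          nlinarith [mul_nonneg hA h0]
      _ ≤ _ := by gcongr
  · have hQ1 : 1 ≤ Q := by linarith
    have hexp : Real.exp (-(2 * L * t ^ 2 / (a + W - a) ^ 2)) ≤ (Q ^ (8 * R * d))⁻¹ * δ := by
      have e1 : X / L + Z / L ≤ (Real.sqrt (X / L) + Real.sqrt (Z / L)) ^ 2 := by
        have := Real.sq_sqrt (show 0 ≤ X / L by positivity)
        have := Real.sq_sqrt (show 0 ≤ Z / L by positivity)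
        nlinarith [mul_nonneg (Real.sqrt_nonneg (X / L)) (Real.sqrt_nonneg (Z / L))]
      have e2 : 8 * X + Z ≤ 2 * L * t ^ 2 / (a + W - a) ^ 2 := by
        have : 2 * L * t ^ 2 / (a + W - a) ^ 2 =
            8 * (L * (Real.sqrt (X / L) + Real.sqrt (Z / L)) ^ 2) := by
          rw [ht, add_sub_cancel_left]
          field_simp
          ring
        rw [this]
        have e3 : (L : ℝ) * (X / L + Z / L) = X + Z := by field_simp
        have := mul_le_mul_of_nonneg_left e1 (by positivity : (0 : ℝ) ≤ L)
        linarith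
      have e4 : Real.exp (-(8 * X + Z)) = (Q ^ (8 * R * d))⁻¹ * δ := by
        rw [neg_add, Real.exp_add, hZ, one_div, Real.log_inv, neg_neg, Real.exp_log hδ,
          Real.exp_neg, hX]
        congr 2
        rw [← Real.exp_log (show 0 < Q ^ (8 * R * d) by positivity), Real.log_pow]
        push_cast
        ring_nf
      rw [← e4]
      exact Real.exp_le_exp.2 (neg_le_neg e2)
    have hI' : (Fintype.card I : ℝ) ≤ Q ^ d :=
      calc (Fintype.card I : ℝ) ≤ 2 ^ d := by exact_mod_cast hI
        _ ≤ Q ^ d := by gcongr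
    have hQ' : 2 ≤ Q ^ d := hQ.trans (le_self_pow₀ hQ1 (by omega))
    -- One factor `Q ^ d` bounds the `2`, another bounds `card I`, and the net contributes `Q ^ (6 *
    -- R * d)`. As `R ≥ 1`, the total exponent is at most `8 * R * d`.
    calc 2 * (Fintype.card I : ℝ) * (1 + 2 * Ω / r) ^ d * Real.exp (-(2 * L * t ^ 2 / (a + W - a) ^ 2))
        ≤ Q ^ d * Q ^ d * (Q ^ (6 * R)) ^ d * ((Q ^ (8 * R * d))⁻¹ * δ) := by gcongr
      _ = Q ^ (d + d + 6 * R * d) * (Q ^ (8 * R * d))⁻¹ * δ := by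
          rw [← pow_mul, ← pow_add, ← pow_add]
          ring
      _ ≤ Q ^ (8 * R * d) * (Q ^ (8 * R * d))⁻¹ * δ := by
          gcongr
          nlinarith [Nat.mul_le_mul_right d hR]
      _ = δ := by
          rw [mul_inv_cancel₀ (by positivity), one_mul]

/-! ### Lipschitz dependence of the network on its parameters. -/

theorem Real.abs_tanh_sub_le (x y : ℝ) : |Real.tanh x - Real.tanh y| ≤ |x - y| := by
  have hd : ∀ u : ℝ, HasDerivAt Real.tanh (1 / Real.cosh u ^ 2) u := fun u => by
    have h := (Real.hasDerivAt_sinh u).div (Real.hasDerivAt_cosh u) (Real.cosh_pos u).ne'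
    have e : Real.tanh = Real.sinh / Real.cosh := funext Real.tanh_eq_sinh_div_cosh
    rw [e]
    rwa [show Real.cosh u * Real.cosh u - Real.sinh u * Real.sinh u = 1 by
      linarith [Real.cosh_sq_sub_sinh_sq u]] at h
  have := Convex.norm_image_sub_le_of_norm_hasDerivWithin_le (C := 1) (s := Set.univ)
    (fun u _ => (hd u).hasDerivWithinAt) (fun u _ => ?_) convex_univ (Set.mem_univ y)
    (Set.mem_univ x)
  · simpa using this
  · rw [Real.norm_eq_abs, abs_of_nonneg (by positivity), div_le_one (by positivity)]
    exact one_le_pow₀ (Real.one_le_cosh u)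

theorem l1norm_nonneg {P : Type} [Fintype P] (ω : P → ℝ) : 0 ≤ l1norm ω :=
  Finset.sum_nonneg fun _ _ => abs_nonneg _

theorem l1norm_comp_le {P Q : Type} [Fintype P] [Fintype Q] (e : Q → P)
    (he : Function.Injective e) (ω : P → ℝ) : l1norm (fun q => ω (e q)) ≤ l1norm ω := by
  classical
  unfold l1norm
  rw [← Finset.sum_image (f := fun p => |ω p|) (s := Finset.univ) (g := e) he.injOn]
  exact Finset.sum_le_sum_of_subset_of_nonneg (Finset.subset_univ _) fun _ _ _ => abs_nonneg _

/-- Split `W z - W' z'` as `(W - W') z + W' (z - z')`. The ℓ¹ norm of all weights bounds the ℓ¹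
operator norm, so no layer width appears. -/
theorem sum_abs_affineLayer_sub_le {ι o : Type} [Fintype ι] [Fintype o]
    (W W' : o × Option ι → ℝ) {z : ι → ℝ} (z' : ι → ℝ) {H : ℝ} (hH : 1 ≤ H)
    (hz : ∀ j, |z j| ≤ H) :
    ∑ k, |affineLayer W z k - affineLayer W' z' k| ≤
      H * l1norm (W - W') + l1norm W' * ∑ j, |z j - z' j| := by
  unfold l1norm
  rw [Fintype.sum_prod_type, Fintype.sum_prod_type, Finset.mul_sum, Finset.sum_mul,
    ← Finset.sum_add_distrib]
  refine Finset.sum_le_sum fun k _ => ?_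
  rw [Fintype.sum_option, Fintype.sum_option]
  set S := ∑ j, |z j - z' j| with hS
  have hS0 : 0 ≤ S := Finset.sum_nonneg fun _ _ => abs_nonneg _
  have e : affineLayer W z k - affineLayer W' z' k = (W - W') (k, none) +
      ∑ j, ((W - W') (k, some j) * z j + W' (k, some j) * (z j - z' j)) := by
    simp only [affineLayer, Pi.sub_apply]
    rw [add_sub_add_comm, ← Finset.sum_sub_distrib]
    congr 1
    exact Finset.sum_congr rfl fun j _ => by ring
  rw [e]
  have h1 : |∑ j, ((W - W') (k, some j) * z j + W' (k, some j) * (z j - z' j))| ≤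
      ∑ j, (H * |(W - W') (k, some j)| + |W' (k, some j)| * S) := by
    refine (Finset.abs_sum_le_sum_abs _ _).trans (Finset.sum_le_sum fun j _ => ?_)
    refine (abs_add_le _ _).trans ?_
    rw [abs_mul, abs_mul, mul_comm]
    gcongr
    · exact hz j
    · exact Finset.single_le_sum (f := fun j => |z j - z' j|) (fun _ _ => abs_nonneg _)
        (Finset.mem_univ j)
  rw [Finset.sum_add_distrib (f := fun j => H * |(W - W') (k, some j)|), ← Finset.mul_sum,
    ← Finset.sum_mul] at h1
  refine (abs_add_le _ _).trans ?_
  nlinarith [abs_nonneg ((W - W') (k, none)), mul_nonneg (abs_nonneg (W' (k, none))) hS0]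

theorem sum_abs_tanhLayer_sub_le {ι o : Type} [Fintype ι] [Fintype o]
    (W W' : o × Option ι → ℝ) {z : ι → ℝ} (z' : ι → ℝ) {H : ℝ} (hH : 1 ≤ H)
    (hz : ∀ j, |z j| ≤ H) :
    ∑ k, |tanhLayer W z k - tanhLayer W' z' k| ≤
      H * l1norm (W - W') + l1norm W' * ∑ j, |z j - z' j| :=
  (Finset.sum_le_sum fun _ _ => Real.abs_tanh_sub_le _ _).trans
    (sum_abs_affineLayer_sub_le W W' z' hH hz)

theorem abs_tanhLayers_le_one {K : ℕ} (n : ℕ) : ∀ (W : Fin n → Fin K × Option (Fin K) → ℝ)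
    (h : Fin K → ℝ), (∀ k, |h k| ≤ 1) → ∀ k, |tanhLayers n W h k| ≤ 1 := by
  induction n with
  | zero => exact fun _ _ hh => hh
  | succ n ih => exact fun W h _ => ih _ _ fun k => (Real.abs_tanh_lt_one _).le

/-- Recursion for the error through one layer: it is multiplied by at most `Ω`, and the perturbation
of that layer's own parameters adds `D`. -/
theorem layer_growth {H D E Ω : ℝ} {m : ℕ} (hH : 1 ≤ H) (hD : 0 ≤ D) (hΩ : 0 ≤ Ω)
    (hE : E ≤ H * D * (1 + Ω) ^ m) : D + Ω * E ≤ H * D * (1 + Ω) ^ (m + 1) := by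
  have h1 : 1 ≤ (1 + Ω) ^ m := one_le_pow₀ (by linarith)
  have h2 : D ≤ H * D * (1 + Ω) ^ m := by
    have : D ≤ H * D := le_mul_of_one_le_left hD hH
    exact this.trans (le_mul_of_one_le_right (by positivity) h1)
  have h3 := mul_le_mul_of_nonneg_left hE hΩ
  rw [pow_succ]
  linarith

theorem sum_abs_tanhLayers_sub_le {K : ℕ} {H D Ω : ℝ} (hH : 1 ≤ H) (hD : 0 ≤ D) (hΩ : 0 ≤ Ω)
    -- The recursion peels layers from the input side, so the induction carries `m`, the exponent
    -- accumulated so far.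
    (n : ℕ) : ∀ (m : ℕ) (W W' : Fin n → Fin K × Option (Fin K) → ℝ) (h h' : Fin K → ℝ),
    (∀ r, l1norm (W r - W' r) ≤ D) → (∀ r, l1norm (W' r) ≤ Ω) → (∀ k, |h k| ≤ 1) →
    ∑ k, |h k - h' k| ≤ H * D * (1 + Ω) ^ m →
    ∑ k, |tanhLayers n W h k - tanhLayers n W' h' k| ≤ H * D * (1 + Ω) ^ (m + n) := by
  induction n with
  | zero => exact fun m W W' h h' _ _ _ hE => hE
  | succ n ih =>
    intro m W W' h h' hW hW' hh hE
    rw [← add_assoc, add_right_comm]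
    refine ih (m + 1) _ _ _ _ (fun r => hW r.succ) (fun r => hW' r.succ)
      (fun k => (Real.abs_tanh_lt_one _).le) ?_
    refine (sum_abs_tanhLayer_sub_le (W 0) (W' 0) h' le_rfl hh).trans
      (le_trans ?_ (layer_growth hH hD hΩ hE))
    rw [one_mul]
    exact add_le_add (hW 0) (mul_le_mul_of_nonneg_right (hW' 0)
      (Finset.sum_nonneg fun _ _ => abs_nonneg _))

theorem sum_abs_network_sub_le {R K : ℕ} {ι o : Type} [Fintype ι] [Fintype o] (hR : 1 ≤ R)
    (ω ω' : ParamIdx R K ι o → ℝ) {z : ι → ℝ} {H Ω : ℝ} (hH : 1 ≤ H) (hz : ∀ j, |z j| ≤ H)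
    (hω' : l1norm ω' ≤ Ω) :
    ∑ k, |network ω z k - network ω' z k| ≤ H * (1 + Ω) ^ R * l1norm (ω - ω') := by
  have hΩ : 0 ≤ Ω := (l1norm_nonneg ω').trans hω'
  have hD := l1norm_nonneg (ω - ω')
  set D := l1norm (ω - ω') with hDdef
  have hsub : ∀ {Q : Type} [Fintype Q] (e : Q → ParamIdx R K ι o), Function.Injective e →
      l1norm ((fun q => ω (e q)) - fun q => ω' (e q)) ≤ D := fun e he =>
    l1norm_comp_le e he (ω - ω')
  have hsub' : ∀ {Q : Type} [Fintype Q] (e : Q → ParamIdx R K ι o), Function.Injective e →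
      l1norm (fun q => ω' (e q)) ≤ Ω := fun e he => (l1norm_comp_le e he ω').trans hω'
  have hmid : ∀ r, Function.Injective
      (fun p => Sum.inr (Sum.inl (r, p)) : Fin K × Option (Fin K) → ParamIdx R K ι o) :=
    fun r p q hpq => by simpa using hpq
  have hlast : Function.Injective
      (fun p => Sum.inr (Sum.inr p) : o × Option (Fin K) → ParamIdx R K ι o) :=
    fun p q hpq => by simpa using hpq
  have h0 : ∑ k, |tanhLayer (fun p => ω (Sum.inl p)) z k -
      tanhLayer (fun p => ω' (Sum.inl p)) z k| ≤ H * D * (1 + Ω) ^ 0 := by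
    refine (sum_abs_tanhLayer_sub_le _ _ z hH hz).trans ?_
    simp only [sub_self, abs_zero, Finset.sum_const_zero, mul_zero, add_zero, pow_zero, mul_one]
    exact mul_le_mul_of_nonneg_left (hsub Sum.inl Sum.inl_injective) (by linarith)
  have hfirst : ∀ k, |tanhLayer (fun p => ω (Sum.inl p)) z k| ≤ 1 :=
    fun k => (Real.abs_tanh_lt_one _).le
  have h1 := sum_abs_tanhLayers_sub_le hH hD hΩ (R - 1) 0
    (fun r p => ω (Sum.inr (Sum.inl (r, p)))) (fun r p => ω' (Sum.inr (Sum.inl (r, p)))) _ _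
    (fun r => hsub _ (hmid r)) (fun r => hsub' _ (hmid r)) hfirst h0
  have h2 := sum_abs_affineLayer_sub_le (fun p => ω (Sum.inr (Sum.inr p)))
    (fun p => ω' (Sum.inr (Sum.inr p)))
    (tanhLayers (R - 1) (fun r p => ω' (Sum.inr (Sum.inl (r, p))))
      (tanhLayer (fun p => ω' (Sum.inl p)) z)) le_rfl (abs_tanhLayers_le_one (R - 1)
      (fun r p => ω (Sum.inr (Sum.inl (r, p)))) _ hfirst)
  refine h2.trans ?_
  -- The first layer contributes exponent `0`, the `R - 1` further hidden layers and the output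
  -- layer one each, `R` in all.
  have h3 := layer_growth hH hD hΩ h1
  rw [zero_add, Nat.sub_add_cancel hR] at h3
  rw [one_mul, mul_right_comm]
  exact le_trans (add_le_add (hsub _ hlast) (mul_le_mul_of_nonneg_right (hsub' _ hlast)
    (Finset.sum_nonneg fun _ _ => abs_nonneg _))) (by simpa using h3)

/-! ### Stability of the two output layers. -/

/-- Numerator and denominator each change by a factor between `exp (-ε)` and `exp ε`, so a share `p
≤ 1` drops by at most `p (1 - exp (-2ε)) ≤ 2ε`. The bound is independent of the number of classes.
-/
theorem softmax_sub_le {κ : Type} [Fintype κ] [Nonempty κ] {s s' : κ → ℝ} {ε : ℝ}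
    (h : ∀ k, |s k - s' k| ≤ ε) (k : κ) :
    Real.exp (s k) / ∑ j, Real.exp (s j) - Real.exp (s' k) / ∑ j, Real.exp (s' j) ≤ 2 * ε := by
  have hpos : ∀ u : κ → ℝ, 0 < ∑ j, Real.exp (u j) := fun u =>
    Finset.sum_pos (fun _ _ => Real.exp_pos _) Finset.univ_nonempty
  have h1 : Real.exp (s k) / ∑ j, Real.exp (s j) ≤ 1 :=
    (div_le_one (hpos s)).2 (Finset.single_le_sum (f := fun j => Real.exp (s j))
      (fun _ _ => (Real.exp_pos _).le) (Finset.mem_univ k))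
  have h0 : 0 ≤ Real.exp (s k) / ∑ j, Real.exp (s j) := (div_pos (Real.exp_pos _) (hpos s)).le
  have h2 : Real.exp (-(2 * ε)) * (Real.exp (s k) / ∑ j, Real.exp (s j)) ≤
      Real.exp (s' k) / ∑ j, Real.exp (s' j) := by
    rw [← mul_div_assoc, div_le_div_iff₀ (hpos s) (hpos s'), Finset.mul_sum, Finset.mul_sum]
    refine Finset.sum_le_sum fun j _ => ?_
    rw [← Real.exp_add, ← Real.exp_add, ← Real.exp_add, Real.exp_le_exp]
    have a1 := (abs_le.1 (h k)).2
    have a2 := (abs_le.1 (h j)).1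
    linarith
  have h3 : 1 - 2 * ε ≤ Real.exp (-(2 * ε)) := by
    linarith [Real.add_one_le_exp (-(2 * ε))]
  have hε : 0 ≤ ε := (abs_nonneg _).trans (h k)
  nlinarith

theorem abs_softmax_sub_le {κ : Type} [Fintype κ] [Nonempty κ] {s s' : κ → ℝ} {ε : ℝ}
    (h : ∀ k, |s k - s' k| ≤ ε) (k : κ) :
    |Real.exp (s k) / ∑ j, Real.exp (s j) - Real.exp (s' k) / ∑ j, Real.exp (s' j)| ≤ 2 * ε := by
  refine abs_le.2 ⟨?_, softmax_sub_le h k⟩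
  have := softmax_sub_le (s := s') (s' := s) (fun k => by rw [abs_sub_comm]; exact h k) k
  linarith

theorem abs_exSOutput_sub_le {N M : ℕ} {s s' : Fin (N + 1) × Fin M → ℝ} {y : Profile N M}
    {bbar : ℝ} (hb : ∀ m, 0 ≤ y.2.2 m ∧ y.2.2 m ≤ bbar) (i : Fin N) (m : Fin M) :
    |exSOutput s y i m - exSOutput s' y i m| ≤ 2 * bbar * ∑ p, |s p - s' p| := by
  have hε : ∀ k, |s (k, m) - s' (k, m)| ≤ ∑ p, |s p - s' p| := fun k =>
    Finset.single_le_sum (f := fun p => |s p - s' p|) (fun _ _ => abs_nonneg _)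
      (Finset.mem_univ (k, m))
  have h := abs_softmax_sub_le (s := fun k => s (k, m)) (s' := fun k => s' (k, m)) hε i.castSucc
  unfold exSOutput
  refine (abs_min_sub_min_le_max _ _ _ _).trans ?_
  rw [sub_self, abs_zero, max_eq_left (abs_nonneg _), ← sub_mul, abs_mul, abs_of_nonneg (hb m).1]
  calc _ ≤ 2 * (∑ p, |s p - s' p|) * bbar := mul_le_mul h (hb m).2 (hb m).1
        (mul_nonneg zero_le_two (Finset.sum_nonneg fun _ _ => abs_nonneg _))
    _ = _ := by ring

theorem midpoint_mem_pfDomain {N M : ℕ} {w : Fin N → ℝ} {y : Profile N M} {a a' : AgentRes N M}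
    (ha : a ∈ pfDomain w y) (ha' : a' ∈ pfDomain w y) :
    (fun i m => (a i m + a' i m) / 2) ∈ pfDomain w y := by
  obtain ⟨⟨h1, h2⟩, h3⟩ := ha
  obtain ⟨⟨h1', h2'⟩, h3'⟩ := ha'
  refine ⟨⟨fun i m => ?_, fun m => ?_⟩, fun i hi => ?_⟩
  · constructor
    · linarith [(h1 i m).1, (h1' i m).1]
    · linarith [(h1 i m).2, (h1' i m).2]
  · rw [← Finset.sum_div, Finset.sum_add_distrib]
    linarith [h2 m, h2' m]
  · have e : ∑ m, (a i m + a' i m) / 2 * y.1 i m =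
        (∑ m, a i m * y.1 i m + ∑ m, a' i m * y.1 i m) / 2 := by
      rw [← Finset.sum_add_distrib, Finset.sum_div]
      exact Finset.sum_congr rfl fun m _ => by ring
    rw [e]
    linarith [h3 i hi, h3' i hi]

theorem log_midpoint_le {p q : ℝ} (hp : 0 < p) (hq : 0 < q) :
    Real.log p + Real.log q ≤ 2 * Real.log ((p + q) / 2) := by
  rw [← Real.log_mul hp.ne' hq.ne', two_mul, ← Real.log_mul (by positivity) (by positivity)]
  exact Real.log_le_log (by positivity) (by nlinarith [sq_nonneg (p - q)])

/-- Strong convexity in midpoint form, for two objectives that differ only in the linear term. The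
logarithms enter through concavity alone, so no derivative is needed near the boundary of the
domain. -/
theorem pfObjective_midpoint_le {N M : ℕ} {w : Fin N → ℝ} (hw : ∀ i, 0 ≤ w i) {ζ : ℝ}
    {y : Profile N M} (z z' : Fin N × Fin M → ℝ) {a a' : AgentRes N M}
    (ha : a ∈ pfDomain w y) (ha' : a' ∈ pfDomain w y) :
    pfObjective w ζ y z (fun i m => (a i m + a' i m) / 2) +
        pfObjective w ζ y z' (fun i m => (a i m + a' i m) / 2) ≤
      pfObjective w ζ y z a + pfObjective w ζ y z' a' -
        ζ / 2 * (∑ i, ∑ m, (a i m - a' i m) ^ 2) +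
        1 / 2 * ∑ i, ∑ m, (a i m - a' i m) * (z' (i, m) - z (i, m)) := by
  have hlog : ∑ i, w i * Real.log (∑ m, a i m * y.1 i m) +
      ∑ i, w i * Real.log (∑ m, a' i m * y.1 i m) ≤
      2 * ∑ i, w i * Real.log (∑ m, (a i m + a' i m) / 2 * y.1 i m) := by
    rw [Finset.mul_sum, ← Finset.sum_add_distrib]
    refine Finset.sum_le_sum fun i _ => ?_
    -- For `w i = 0` the domain does not force the argument of the logarithm to be positive, but the
    -- term vanishes.
    rcases (hw i).eq_or_lt with h0 | hpos
    · simp [← h0]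
    · have e : ∑ m, (a i m + a' i m) / 2 * y.1 i m =
          (∑ m, a i m * y.1 i m + ∑ m, a' i m * y.1 i m) / 2 := by
        rw [← Finset.sum_add_distrib, Finset.sum_div]
        exact Finset.sum_congr rfl fun m _ => by ring
      rw [e, ← mul_add, mul_left_comm]
      exact mul_le_mul_of_nonneg_left (log_midpoint_le (ha.2 i hpos) (ha'.2 i hpos)) hpos.le
  have hsq : 2 * ∑ i, ∑ m, ((a i m + a' i m) / 2) ^ 2 =
      ∑ i, ∑ m, a i m ^ 2 + ∑ i, ∑ m, a' i m ^ 2 - 1 / 2 * ∑ i, ∑ m, (a i m - a' i m) ^ 2 := by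
    simp only [Finset.mul_sum, ← Finset.sum_add_distrib, ← Finset.sum_sub_distrib]
    exact Finset.sum_congr rfl fun i _ => Finset.sum_congr rfl fun m _ => by ring
  have hlin : ∑ i, ∑ m, (a i m + a' i m) / 2 * z (i, m) +
      ∑ i, ∑ m, (a i m + a' i m) / 2 * z' (i, m) =
      ∑ i, ∑ m, a i m * z (i, m) + ∑ i, ∑ m, a' i m * z' (i, m) +
        1 / 2 * ∑ i, ∑ m, (a i m - a' i m) * (z' (i, m) - z (i, m)) := by
    simp only [Finset.mul_sum, ← Finset.sum_add_distrib]
    exact Finset.sum_congr rfl fun i _ => Finset.sum_congr rfl fun m _ => by ring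
  unfold pfObjective
  linear_combination hlog + ζ * hsq + hlin

/-- Testing both minimizers against their midpoint gives `ζ ‖a - a'‖₂² ≤ ⟨a - a', z' - z⟩`. With `T`
the sup norm of `a - a'`, the left side is at least `ζ T²` and the right side at most `T ‖z - z'‖₁`,
by ℓ^∞–ℓ¹ duality. -/
theorem abs_sub_le_of_isMinOn_pfObjective {N M : ℕ} {w : Fin N → ℝ} (hw : ∀ i, 0 ≤ w i) {ζ : ℝ}
    (hζ : 0 < ζ) {y : Profile N M} {z z' : Fin N × Fin M → ℝ} {a a' : AgentRes N M}
    (ha : a ∈ pfDomain w y) (ha' : a' ∈ pfDomain w y)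
    (hmin : IsMinOn (pfObjective w ζ y z) (pfDomain w y) a)
    (hmin' : IsMinOn (pfObjective w ζ y z') (pfDomain w y) a') (i : Fin N) (m : Fin M) :
    |a i m - a' i m| ≤ 1 / ζ * ∑ p, |z p - z' p| := by
  have hmid := midpoint_mem_pfDomain ha ha'
  have h1 : pfObjective w ζ y z a ≤ _ := hmin hmid
  have h2 : pfObjective w ζ y z' a' ≤ _ := hmin' hmid
  have h3 := pfObjective_midpoint_le hw (ζ := ζ) z z' ha ha'
  have h4 : ζ * (∑ i, ∑ m, (a i m - a' i m) ^ 2) ≤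
      ∑ i, ∑ m, (a i m - a' i m) * (z' (i, m) - z (i, m)) := by linarith
  simp only [← Fintype.sum_prod_type'] at h4
  have : Nonempty (Fin N × Fin M) := ⟨(i, m)⟩
  obtain ⟨q, hq⟩ := Finite.exists_max fun p : Fin N × Fin M => |a p.1 p.2 - a' p.1 p.2|
  set T := |a q.1 q.2 - a' q.1 q.2| with hT
  set S := ∑ p, |z p - z' p| with hS
  have hS0 : 0 ≤ S := Finset.sum_nonneg fun _ _ => abs_nonneg _
  have h5 : T ^ 2 ≤ ∑ p : Fin N × Fin M, (a p.1 p.2 - a' p.1 p.2) ^ 2 := by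
    rw [hT, sq_abs]
    exact Finset.single_le_sum (f := fun p : Fin N × Fin M => (a p.1 p.2 - a' p.1 p.2) ^ 2)
      (fun _ _ => sq_nonneg _) (Finset.mem_univ q)
  have h6 : ∑ p : Fin N × Fin M, (a p.1 p.2 - a' p.1 p.2) * (z' (p.1, p.2) - z (p.1, p.2)) ≤
      T * S := by
    rw [hS, Finset.mul_sum]
    refine Finset.sum_le_sum fun p _ => (le_abs_self _).trans ?_
    rw [abs_mul, abs_sub_comm (z' _)]
    exact mul_le_mul_of_nonneg_right (hq p) (abs_nonneg _)
  have h7 : ζ * T ≤ S := by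
    have hT0 : 0 ≤ T := abs_nonneg _
    rcases hT0.eq_or_lt with h0 | hpos
    · nlinarith
    · have : ζ * T ^ 2 ≤ T * S := (mul_le_mul_of_nonneg_left h5 hζ.le).trans (h4.trans h6)
      nlinarith
  refine (hq (i, m)).trans ?_
  rw [one_div, inv_mul_eq_div, le_div_iff₀ hζ]
  linarith

/-- A nonzero output cannot be the default value, so it is a genuine minimizer. -/
theorem exPFOutput_spec {N M : ℕ} {w : Fin N → ℝ} {ζ : ℝ} {z : Fin N × Fin M → ℝ}
    {y : Profile N M} (h : exPFOutput w ζ z y ≠ 0) :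
    exPFOutput w ζ z y ∈ pfDomain w y ∧
      IsMinOn (pfObjective w ζ y z) (pfDomain w y) (exPFOutput w ζ z y) := by
  unfold exPFOutput at h ⊢
  split_ifs at h ⊢ with hex
  · exact hex.choose_spec
  · exact absurd rfl h

theorem mechanism_nonneg {A : Arch} {R K N M : ℕ} {w : Fin N → ℝ} {ζ : ℝ}
    (ω : MechParam A R K N M → ℝ) {y : Profile N M} (hx : ∀ i m, 0 ≤ y.2.1 i m)
    (hb : ∀ m, 0 ≤ y.2.2 m) (i : Fin N) (m : Fin M) : 0 ≤ mechanism A w ζ ω y i m := by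
  cases A with
  | exS =>
    exact le_min (mul_nonneg (div_nonneg (Real.exp_pos _).le
      (Finset.sum_nonneg fun _ _ => (Real.exp_pos _).le)) (hb m)) (hx i m)
  | exPF =>
    by_cases h : exPFOutput w ζ (network ω (flatten y)) y = 0
    · exact (congrFun (congrFun h i) m).ge
    · exact ((exPFOutput_spec h).1.1.1 i m).1

theorem abs_mechanism_sub_le {A : Arch} {R K N M : ℕ} (hR : 1 ≤ R) {w : Fin N → ℝ}
    (hw : ∀ i, 0 ≤ w i) {ζ₀ ζ : ℝ} (hζ₀ : 0 < ζ₀) (hζ : ζ₀ ≤ ζ) {ω ω' : MechParam A R K N M → ℝ}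
    {Ω H bbar : ℝ} (hH : 1 ≤ H) (hω' : l1norm ω' ≤ Ω) {y : Profile N M}
    (hy : ∀ j, |flatten y j| ≤ H) (hb : ∀ m, 0 ≤ y.2.2 m ∧ y.2.2 m ≤ bbar)
    (h0 : mechanism A w ζ ω y ≠ 0) (h0' : mechanism A w ζ ω' y ≠ 0) (i : Fin N) (m : Fin M) :
    |mechanism A w ζ ω y i m - mechanism A w ζ ω' y i m| ≤
      max (2 * bbar) (1 / ζ₀) * (H * (1 + Ω) ^ R * l1norm (ω - ω')) := by
  have hnet := sum_abs_network_sub_le hR ω ω' hH hy hω'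
  have hmax : 0 ≤ max (2 * bbar) (1 / ζ₀) := le_max_of_le_right (by positivity)
  cases A with
  | exS =>
    refine (abs_exSOutput_sub_le hb i m).trans ?_
    exact mul_le_mul (le_max_left _ _) hnet (Finset.sum_nonneg fun _ _ => abs_nonneg _) hmax
  | exPF =>
    obtain ⟨h1, h2⟩ := exPFOutput_spec h0
    obtain ⟨h1', h2'⟩ := exPFOutput_spec h0'
    refine (abs_sub_le_of_isMinOn_pfObjective hw (hζ₀.trans_le hζ) h1 h1' h2 h2' i m).trans ?_
    exact mul_le_mul ((one_div_le_one_div_of_le hζ₀ hζ).trans (le_max_right _ _)) hnet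
      (Finset.sum_nonneg fun _ _ => abs_nonneg _) hmax

/-! ### Bounds and Lipschitz estimates for utility and welfare. -/

theorem utility_zero {N M : ℕ} {v x : AgentRes N M} (hx : ∀ i m, 0 ≤ x i m) (i : Fin N) :
    utility 0 v x i = 0 :=
  Finset.sum_eq_zero fun m _ => by simp [hx i m]

theorem abs_utility_sub_le {N M : ℕ} {a a' v x : AgentRes N M} {i : Fin N} {ε : ℝ} (hε : 0 ≤ ε)
    (hv : ∀ m, 0 ≤ v i m) (hv1 : ∑ m, v i m ≤ 1) (h : ∀ m, |a i m - a' i m| ≤ ε) :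
    |utility a v x i - utility a' v x i| ≤ ε := by
  unfold utility
  rw [← Finset.sum_sub_distrib]
  calc |∑ m, (v i m * min (a i m) (x i m) - v i m * min (a' i m) (x i m))|
      ≤ ∑ m, v i m * ε := by
        refine (Finset.abs_sum_le_sum_abs _ _).trans (Finset.sum_le_sum fun m _ => ?_)
        rw [← mul_sub, abs_mul, abs_of_nonneg (hv m)]
        refine mul_le_mul_of_nonneg_left ((abs_min_sub_min_le_max _ _ _ _).trans ?_) (hv m)
        rw [sub_self, abs_zero]
        exact max_le (h m) hε
    _ ≤ ε := by
        rw [← Finset.sum_mul]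
        exact mul_le_of_le_one_left hε hv1

theorem utility_mem_Icc {N M : ℕ} {a v x : AgentRes N M} {i : Fin N} {xbar : ℝ} (hxbar : 0 ≤ xbar)
    (hv : ∀ m, 0 ≤ v i m) (hv1 : ∑ m, v i m ≤ 1) (ha : ∀ m, 0 ≤ a i m)
    (hx : ∀ m, 0 ≤ x i m ∧ x i m ≤ xbar) : utility a v x i ∈ Set.Icc 0 xbar := by
  refine ⟨Finset.sum_nonneg fun m _ => mul_nonneg (hv m) (le_min (ha m) (hx m).1), ?_⟩
  calc utility a v x i ≤ ∑ m, v i m * xbar := Finset.sum_le_sum fun m _ =>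
        mul_le_mul_of_nonneg_left ((min_le_right _ _).trans (hx m).2) (hv m)
    _ ≤ xbar := by
        rw [← Finset.sum_mul]
        exact mul_le_of_le_one_left hxbar hv1

/-- From `log (p/q) ≤ p/q - 1 = (p - q)/q` and `1/q ≤ ψ`, used in both directions. -/
theorem Real.abs_log_sub_le {ψ p q : ℝ} (hψ : 0 < ψ) (hp : 1 / ψ ≤ p) (hq : 1 / ψ ≤ q) :
    |Real.log p - Real.log q| ≤ ψ * |p - q| := by
  have key : ∀ p q : ℝ, 1 / ψ ≤ p → 1 / ψ ≤ q → Real.log p - Real.log q ≤ ψ * |p - q| := by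
    intro p q hp hq
    have hp0 : 0 < p := (one_div_pos.2 hψ).trans_le hp
    have hq0 : 0 < q := (one_div_pos.2 hψ).trans_le hq
    rw [← Real.log_div hp0.ne' hq0.ne']
    calc Real.log (p / q) ≤ p / q - 1 := Real.log_le_sub_one_of_pos (by positivity)
      _ = 1 / q * (p - q) := by field_simp
      _ ≤ 1 / q * |p - q| := mul_le_mul_of_nonneg_left (le_abs_self _) (by positivity)
      _ ≤ ψ * |p - q| := by
        refine mul_le_mul_of_nonneg_right ?_ (abs_nonneg _)
        rwa [one_div_le hq0 hψ]
  refine abs_le.2 ⟨?_, key p q hp hq⟩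
  have := key q p hq hp
  rw [abs_sub_comm] at this
  linarith

theorem abs_logNSW_le {N M : ℕ} {w : Fin N → ℝ} {wbar ψ : ℝ} (hw : ∀ i, 0 ≤ w i ∧ w i ≤ wbar)
    (hψ : 0 < ψ) {f : Profile N M → AgentRes N M} {y : Profile N M}
    (h : ∀ i, 1 / ψ ≤ utility (f y) y.1 y.2.1 i ∧ utility (f y) y.1 y.2.1 i ≤ ψ) :
    |logNSW w f y| ≤ N * wbar * Real.log ψ := by
  calc |logNSW w f y| ≤ ∑ _i : Fin N, wbar * Real.log ψ := by
        refine (Finset.abs_sum_le_sum_abs _ _).trans (Finset.sum_le_sum fun i _ => ?_)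
        rw [abs_mul, abs_of_nonneg (hw i).1]
        have hpos : 0 < 1 / ψ := one_div_pos.2 hψ
        have h1 := Real.log_le_log hpos (h i).1
        have h2 := Real.log_le_log (hpos.trans_le (h i).1) (h i).2
        rw [one_div, Real.log_inv] at h1
        exact mul_le_mul (hw i).2 (abs_le.2 ⟨h1, h2⟩) (abs_nonneg _) ((hw i).1.trans (hw i).2)
    _ = N * wbar * Real.log ψ := by simp [mul_assoc]

theorem abs_logNSW_sub_le {N M : ℕ} {w : Fin N → ℝ} {wbar ψ ε : ℝ}
    (hw : ∀ i, 0 ≤ w i ∧ w i ≤ wbar) (hψ : 0 < ψ) {f g : Profile N M → AgentRes N M}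
    {y : Profile N M} (hf : ∀ i, 1 / ψ ≤ utility (f y) y.1 y.2.1 i)
    (hg : ∀ i, 1 / ψ ≤ utility (g y) y.1 y.2.1 i)
    (h : ∀ i, |utility (f y) y.1 y.2.1 i - utility (g y) y.1 y.2.1 i| ≤ ε) :
    |logNSW w f y - logNSW w g y| ≤ N * wbar * ψ * ε := by
  unfold logNSW
  rw [← Finset.sum_sub_distrib]
  calc _ ≤ ∑ _i : Fin N, wbar * (ψ * ε) := by
        refine (Finset.abs_sum_le_sum_abs _ _).trans (Finset.sum_le_sum fun i _ => ?_)
        rw [← mul_sub, abs_mul, abs_of_nonneg (hw i).1]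
        exact mul_le_mul (hw i).2 ((Real.abs_log_sub_le hψ (hf i) (hg i)).trans
          (mul_le_mul_of_nonneg_left (h i) hψ.le)) (abs_nonneg _) ((hw i).1.trans (hw i).2)
    _ = N * wbar * ψ * ε := by simp [mul_assoc]

/-! ### Bounds and Lipschitz estimate for exploitability. -/

theorem misreport_self {N M : ℕ} (y : Profile N M) (i : Fin N) :
    misreport y i (y.1 i, y.2.1 i) = y := by
  simp [misreport]

section Exploitability

variable {N M : ℕ} {V D : Set (AgentRes N M)} {B : Set (Fin M → ℝ)} {xbar : ℝ}
  {f g : Profile N M → AgentRes N M}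

theorem misreport_mem {i : Fin N} {y : Profile N M} (hy : y ∈ V ×ˢ D ×ˢ B)
    {r : (Fin M → ℝ) × (Fin M → ℝ)} (hr : (misreport y i r).1 ∈ V ∧ (misreport y i r).2.1 ∈ D) :
    misreport y i r ∈ V ×ˢ D ×ˢ B :=
  ⟨hr.1, hr.2, hy.2.2⟩

theorem utility_misreport_mem_Icc (hV : ∀ v ∈ V, (∀ i m, 0 ≤ v i m) ∧ ∀ i, ∑ m, v i m ≤ 1)
    (hD : ∀ x ∈ D, ∀ i m, 0 ≤ x i m ∧ x i m ≤ xbar) (hxbar : 0 ≤ xbar)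
    (hf : ∀ y ∈ V ×ˢ D ×ˢ B, ∀ i m, 0 ≤ f y i m) {i : Fin N} {y : Profile N M}
    (hy : y ∈ V ×ˢ D ×ˢ B) {r : (Fin M → ℝ) × (Fin M → ℝ)}
    (hr : (misreport y i r).1 ∈ V ∧ (misreport y i r).2.1 ∈ D) :
    utility (f (misreport y i r)) y.1 y.2.1 i ∈ Set.Icc 0 xbar :=
  utility_mem_Icc hxbar ((hV _ hy.1).1 i) ((hV _ hy.1).2 i)
    (hf _ (misreport_mem hy hr) i) (hD _ hy.2.1 i)

theorem bddAbove_utility_misreport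
    (hV : ∀ v ∈ V, (∀ i m, 0 ≤ v i m) ∧ ∀ i, ∑ m, v i m ≤ 1)
    (hD : ∀ x ∈ D, ∀ i m, 0 ≤ x i m ∧ x i m ≤ xbar) (hxbar : 0 ≤ xbar)
    (hf : ∀ y ∈ V ×ˢ D ×ˢ B, ∀ i m, 0 ≤ f y i m) {i : Fin N} {y : Profile N M}
    (hy : y ∈ V ×ˢ D ×ˢ B) :
    BddAbove ((fun r => utility (f (misreport y i r)) y.1 y.2.1 i) ''
      {r | (misreport y i r).1 ∈ V ∧ (misreport y i r).2.1 ∈ D}) := by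
  refine ⟨xbar, ?_⟩
  rintro _ ⟨r, hr, rfl⟩
  exact (utility_misreport_mem_Icc hV hD hxbar hf hy hr).2

theorem truthful_mem {i : Fin N} {y : Profile N M} (hy : y ∈ V ×ˢ D ×ˢ B) :
    (y.1 i, y.2.1 i) ∈ {r | (misreport y i r).1 ∈ V ∧ (misreport y i r).2.1 ∈ D} := by
  simp only [Set.mem_ofPred_eq, misreport_self]
  exact ⟨hy.1, hy.2.1⟩

/-- The truthful report is an admissible misreport, which gives nonnegativity; the utilities lie in
`[0, xbar]`, which gives the upper bound. -/
theorem exploitability_mem_Icc (hV : ∀ v ∈ V, (∀ i m, 0 ≤ v i m) ∧ ∀ i, ∑ m, v i m ≤ 1)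
    (hD : ∀ x ∈ D, ∀ i m, 0 ≤ x i m ∧ x i m ≤ xbar) (hxbar : 0 ≤ xbar)
    (hf : ∀ y ∈ V ×ˢ D ×ˢ B, ∀ i m, 0 ≤ f y i m) (i : Fin N) {y : Profile N M}
    (hy : y ∈ V ×ˢ D ×ˢ B) : exploitability V D f i y ∈ Set.Icc 0 xbar := by
  have ht := truthful_mem (i := i) hy
  have h1 := le_csSup (bddAbove_utility_misreport hV hD hxbar hf hy) ⟨_, ht, rfl⟩
  have h2 := csSup_le (Set.Nonempty.image _ ⟨_, ht⟩) (a := xbar) (by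
    rintro _ ⟨r, hr, rfl⟩
    exact (utility_misreport_mem_Icc hV hD hxbar hf hy hr).2)
  have h3 := (utility_misreport_mem_Icc hV hD hxbar hf hy ht).1
  simp only [misreport_self] at h1 h3
  unfold exploitability
  exact ⟨by linarith, by linarith⟩

/-- One `ε` comes from the supremum and one from the truthful utility. Closeness of `f` and `g` is
needed on the whole profile space, because the supremum evaluates them at all misreports. -/
theorem abs_exploitability_sub_le (hV : ∀ v ∈ V, (∀ i m, 0 ≤ v i m) ∧ ∀ i, ∑ m, v i m ≤ 1)
    (hD : ∀ x ∈ D, ∀ i m, 0 ≤ x i m ∧ x i m ≤ xbar) (hxbar : 0 ≤ xbar)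
    (hf : ∀ y ∈ V ×ˢ D ×ˢ B, ∀ i m, 0 ≤ f y i m) (hg : ∀ y ∈ V ×ˢ D ×ˢ B, ∀ i m, 0 ≤ g y i m)
    {ε : ℝ} (hε : 0 ≤ ε) (h : ∀ y ∈ V ×ˢ D ×ˢ B, ∀ i m, |f y i m - g y i m| ≤ ε) (i : Fin N)
    {y : Profile N M} (hy : y ∈ V ×ˢ D ×ˢ B) :
    |exploitability V D f i y - exploitability V D g i y| ≤ 2 * ε := by
  have key : ∀ {f g : Profile N M → AgentRes N M},
      (∀ y ∈ V ×ˢ D ×ˢ B, ∀ i m, 0 ≤ g y i m) →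
      (∀ y ∈ V ×ˢ D ×ˢ B, ∀ i m, |f y i m - g y i m| ≤ ε) →
      exploitability V D f i y - exploitability V D g i y ≤ 2 * ε := by
    intro f g hg h
    have hu : ∀ y' ∈ V ×ˢ D ×ˢ B,
        |utility (f y') y.1 y.2.1 i - utility (g y') y.1 y.2.1 i| ≤ ε := fun y' hy' =>
      abs_utility_sub_le hε ((hV _ hy.1).1 i) ((hV _ hy.1).2 i) (h y' hy' i)
    have h1 := csSup_le (Set.Nonempty.image (fun r => utility (f (misreport y i r)) y.1 y.2.1 i)
      ⟨_, truthful_mem (i := i) hy⟩)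
      (a := sSup ((fun r => utility (g (misreport y i r)) y.1 y.2.1 i) ''
        {r | (misreport y i r).1 ∈ V ∧ (misreport y i r).2.1 ∈ D}) + ε) (by
      rintro _ ⟨r, hr, rfl⟩
      have h2 := le_csSup (bddAbove_utility_misreport hV hD hxbar hg hy) ⟨r, hr, rfl⟩
      have h3 := (abs_le.1 (hu _ (misreport_mem hy hr))).2
      simp only at h2 ⊢
      linarith)
    have h4 := (abs_le.1 (hu y hy)).1
    unfold exploitability
    linarith
  refine abs_le.2 ⟨?_, key hg h⟩
  have := key (f := g) (g := f) hf fun y hy i m => by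
    rw [abs_sub_comm]
    exact h y hy i m
  linarith

end Exploitability

/-! ### Choice of constants and the theorem. -/

theorem abs_flatten_le {N M : ℕ} {y : Profile N M} {xbar bbar : ℝ}
    (hv : (∀ i m, 0 ≤ y.1 i m) ∧ ∀ i, ∑ m, y.1 i m ≤ 1)
    (hx : ∀ i m, 0 ≤ y.2.1 i m ∧ y.2.1 i m ≤ xbar) (hb : ∀ m, 0 ≤ y.2.2 m ∧ y.2.2 m ≤ bbar)
    (j : InputIdx N M) : |flatten y j| ≤ max 1 (max xbar bbar) := by
  rcases j with ⟨i, m⟩ | ⟨i, m⟩ | m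
  · refine (abs_of_nonneg (hv.1 i m)).trans_le (le_max_of_le_left ?_)
    exact (Finset.single_le_sum (fun m _ => hv.1 i m) (Finset.mem_univ m)).trans (hv.2 i)
  · exact (abs_of_nonneg (hx i m).1).trans_le
      (le_max_of_le_right (le_max_of_le_left (hx i m).2))
  · exact (abs_of_nonneg (hb m).1).trans_le
      (le_max_of_le_right (le_max_of_le_right (hb m).2))

/-- Each agent has its own weight into the first hidden node. Hence a union bound over the agents
costs at most `N ≤ 2 ^ d`. -/
theorem le_numParams (A : Arch) {R K N M : ℕ} (hK : 1 ≤ K) (hM : 1 ≤ M) :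
    N ≤ numParams A R K N M := by
  have := Fintype.card_le_of_injective
    (fun i : Fin N => (Sum.inl (⟨0, hK⟩, some (Sum.inl (i, ⟨0, hM⟩))) : MechParam A R K N M))
    (fun i j hij => by simpa using hij)
  rwa [Fintype.card_fin] at this

/-- The net size for the mesh `r = 1 / (G (1 + Ω)^R)`. The exponent `6 * R` comes from `1 + Q ≤ Q ^
2` and `2 * (R + 2) ≤ 6 * R`. -/
theorem covering_base_le {Q Ω G : ℝ} {R : ℕ} (hR : 1 ≤ R) (hQ : 2 ≤ Q) (hΩ : 0 ≤ Ω) (hΩQ : Ω ≤ Q)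
    (hG : G * Ω ≤ Q) : 1 + 2 * Ω / (1 / (G * (1 + Ω) ^ R)) ≤ Q ^ (6 * R) := by
  have h1 : (1 + Ω) ^ R ≤ (1 + Q) ^ R := by gcongr
  have h2 : 1 ≤ (1 + Q) ^ R := one_le_pow₀ (by linarith)
  calc 1 + 2 * Ω / (1 / (G * (1 + Ω) ^ R)) = 1 + 2 * (G * Ω) * (1 + Ω) ^ R := by
        rw [div_div_eq_mul_div, div_one]
        ring
    _ ≤ 1 + 2 * Q * (1 + Q) ^ R := by gcongr
    _ ≤ (1 + Q) ^ R * (1 + Q) ^ 2 := by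
        nlinarith [mul_nonneg (sq_nonneg Q) (zero_le_one.trans h2)]
    _ = (1 + Q) ^ (R + 2) := by rw [← pow_add]
    _ ≤ (Q ^ 2) ^ (R + 2) := by
        refine pow_le_pow_left₀ (by linarith) ?_ _
        nlinarith
    _ = Q ^ (2 * (R + 2)) := by rw [← pow_mul]
    _ ≤ Q ^ (6 * R) := pow_le_pow_right₀ (by linarith) (by omega)

theorem theorem2 (xbar bbar wbar ζ₀ : ℝ) (hζ₀ : 0 < ζ₀) :
    ∃ C : ℝ, 0 < C ∧
      ∀ (A : Arch) (N M R K L : ℕ), 1 ≤ N → 1 ≤ M → 1 ≤ R → 1 ≤ K →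
      ∀ (Ω ψ δ ζ : ℝ), 0 < ψ → 0 < δ → δ < 1 → ζ₀ ≤ ζ →
      2 ≤ (L : ℝ) * Ω * max (K : ℝ) ((M : ℝ) * N) →
      ∀ (w : Fin N → ℝ), (∀ i, 0 ≤ w i ∧ w i ≤ wbar) →
      ∀ (V D : Set (AgentRes N M)) (B : Set (Fin M → ℝ)),
      (∀ v ∈ V, (∀ i m, 0 ≤ v i m) ∧ ∀ i, ∑ m, v i m ≤ 1) →
      (∀ x ∈ D, ∀ i m, 0 ≤ x i m ∧ x i m ≤ xbar) →
      (∀ b ∈ B, ∀ m, 0 ≤ b m ∧ b m ≤ bbar) →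
      ∀ (F : Measure (Profile N M)) [IsProbabilityMeasure F],
      (∀ᵐ y ∂F, y ∈ V ×ˢ D ×ˢ B) →
      -- every utility lies in `[1/ψ, ψ]`
      (∀ ω : MechParam A R K N M → ℝ, l1norm ω ≤ Ω → ∀ y ∈ V ×ˢ D ×ˢ B, ∀ i,
        1 / ψ ≤ utility (mechanism A w ζ ω y) y.1 y.2.1 i ∧
          utility (mechanism A w ζ ω y) y.1 y.2.1 i ≤ ψ) →
      -- the random variables below are measurable
      (∀ ω : MechParam A R K N M → ℝ, l1norm ω ≤ Ω →
        AEStronglyMeasurable (logNSW w (mechanism A w ζ ω)) F ∧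
          ∀ i, AEStronglyMeasurable (exploitability V D (mechanism A w ζ ω) i) F) →
      -- with probability at least `1 - δ`, simultaneously for all parameters: welfare
      Measure.pi (fun _ : Fin L => F)
          {S | ¬ ∀ ω : MechParam A R K N M → ℝ, l1norm ω ≤ Ω →
            genError F S (fun y => -logNSW w (mechanism A w ζ ω) y) ≤
              C * N * (1 + Real.log ψ) *
                (Real.sqrt (R * numParams A R K N M *
                    Real.log (ψ * L * Ω * max (K : ℝ) ((M : ℝ) * N)) / L)
                  + Real.sqrt (Real.log (1 / δ) / L))}
        ≤ ENNReal.ofReal δ ∧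
      -- with probability at least `1 - δ`, simultaneously for all parameters and all agents:
      -- exploitability
      Measure.pi (fun _ : Fin L => F)
          {S | ¬ ∀ ω : MechParam A R K N M → ℝ, l1norm ω ≤ Ω → ∀ i,
            genError F S (exploitability V D (mechanism A w ζ ω) i) ≤
              C * (Real.sqrt (R * numParams A R K N M *
                    Real.log (L * N * Ω * max (K : ℝ) ((M : ℝ) * N)) / L)
                  + Real.sqrt (Real.log (1 / δ) / L))}
        ≤ ENNReal.ofReal δ := by
  set c : ℝ := max (2 * bbar) (1 / ζ₀) with hc
  set H : ℝ := max 1 (max xbar bbar) with hH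
  have hc0 : 0 ≤ c := le_max_of_le_right (by positivity)
  have hH1 : 1 ≤ H := le_max_left _ _
  have hH0 : 0 ≤ H := zero_le_one.trans hH1
  -- The first two summands serve welfare, the last two exploitability, each as `2 W + 4 A`.
  -- Absolute values appear because the signs of `wbar` and `xbar` are known only once `N, M ≥ 1`
  -- and a profile are given.
  refine ⟨4 * (|wbar| + 1) + 4 * (|wbar| * (c * H)) + 2 * (|xbar| + 1) + 8 * (c * H),
    by positivity, ?_⟩
  intro A N M R K L hN hM hR hK Ω ψ δ ζ hψ hδ hδ1 hζ hLΩ w hw V D B hV hD hB F _ hF hu hmeas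
  have hNr : (1 : ℝ) ≤ N := by exact_mod_cast hN
  set m : ℝ := max (K : ℝ) ((M : ℝ) * N) with hm
  have hm1 : 1 ≤ m := le_max_of_le_left (by exact_mod_cast hK)
  have hL : 0 < L := by
    rcases Nat.eq_zero_or_pos L with rfl | h
    · norm_num at hLΩ
    · exact h
  have hLr : (1 : ℝ) ≤ L := by exact_mod_cast hL
  have hΩ : 0 ≤ Ω := by
    by_contra! h
    have : (L : ℝ) * Ω * m ≤ 0 :=
      mul_nonpos_of_nonpos_of_nonneg (mul_nonpos_of_nonneg_of_nonpos (by positivity) h.le)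
        (by positivity)
    linarith
  have hLΩm : (L : ℝ) * Ω ≤ L * Ω * m := le_mul_of_one_le_right (by positivity) hm1
  have hΩL : Ω ≤ L * Ω := le_mul_of_one_le_left hΩ hLr
  obtain ⟨y₀, hy₀⟩ := hF.exists
  have i₀ : Fin N := ⟨0, hN⟩
  have hwbar : 0 ≤ wbar := (hw i₀).1.trans (hw i₀).2
  have hxbar : 0 ≤ xbar := (hD _ hy₀.2.1 i₀ ⟨0, hM⟩).1.trans (hD _ hy₀.2.1 i₀ ⟨0, hM⟩).2
  -- The zero parameter vector lies in the ball, so `1/ψ ≤ ψ`.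
  have hψ1 : 1 ≤ ψ := by
    have h := hu 0 (by simpa [l1norm] using hΩ) y₀ hy₀ i₀
    have h' := h.1.trans h.2
    rw [div_le_iff₀ hψ] at h'
    nlinarith
  have hlogψ : 0 ≤ Real.log ψ := Real.log_nonneg hψ1
  rw [abs_of_nonneg hwbar, abs_of_nonneg hxbar]
  -- The zero allocation has utility `0 < 1/ψ`, so the default value of `exPFOutput` never occurs.
  have hne : ∀ ω : MechParam A R K N M → ℝ, l1norm ω ≤ Ω → ∀ y ∈ V ×ˢ D ×ˢ B,
      mechanism A w ζ ω y ≠ 0 := by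
    intro ω hω y hy h0
    have h := (hu ω hω y hy i₀).1
    rw [h0, utility_zero fun i m => (hD _ hy.2.1 i m).1] at h
    exact absurd h (not_le.2 (by positivity))
  have hnn : ∀ ω : MechParam A R K N M → ℝ, ∀ y ∈ V ×ˢ D ×ˢ B, ∀ i m,
      0 ≤ mechanism A w ζ ω y i m := fun ω y hy =>
    mechanism_nonneg ω (fun i m => (hD _ hy.2.1 i m).1) fun m => (hB _ hy.2.2 m).1
  have hlip : ∀ ω ω' : MechParam A R K N M → ℝ, l1norm ω ≤ Ω → l1norm ω' ≤ Ω →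
      ∀ y ∈ V ×ˢ D ×ˢ B, ∀ i m, |mechanism A w ζ ω y i m - mechanism A w ζ ω' y i m| ≤
        c * (H * (1 + Ω) ^ R * l1norm (ω - ω')) := fun ω ω' hω hω' y hy =>
    abs_mechanism_sub_le hR (fun i => (hw i).1) hζ₀ hζ hH1 hω'
      (abs_flatten_le (hV _ hy.1) (hD _ hy.2.1) (hB _ hy.2.2)) (hB _ hy.2.2)
      (hne ω hω y hy) (hne ω' hω' y hy)
  have hε : ∀ ω ω' : MechParam A R K N M → ℝ,
      0 ≤ c * (H * (1 + Ω) ^ R * l1norm (ω - ω')) := fun ω ω' => by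
    have := l1norm_nonneg (ω - ω')
    positivity
  have hd : N ≤ Fintype.card (MechParam A R K N M) := le_numParams A hK hM
  have hd0 : 0 < Fintype.card (MechParam A R K N M) := by omega
  constructor
  -- Width of the interval containing the welfare loss; `wbar + 1` keeps it positive when `wbar =
  -- 0`.
  · set W : ℝ := 2 * (N * (wbar + 1) * (1 + Real.log ψ)) with hW
    have hW0 : 0 < W := by positivity
    have hG0 : 0 < L * ψ * (1 + Ω) ^ R := by positivity
    have h1 : (L : ℝ) * Ω * m ≤ ψ * L * Ω * m := by
      have : (L : ℝ) * Ω * m ≤ ψ * (L * Ω * m) := le_mul_of_one_le_left (by positivity) hψ1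
      linarith
    have hψQ : L * ψ * Ω ≤ ψ * L * Ω * m := by
      have : ψ * L * Ω ≤ ψ * L * Ω * m := le_mul_of_one_le_right (by positivity) hm1
      linarith
    have := measure_pi_uniform_genError_rate F hL hF
      (fun (ω : MechParam A R K N M → ℝ) (_ : Unit) y => -logNSW w (mechanism A w ζ ω) y)
      -- The mesh cancels `ψ` and `(1 + Ω)^R` in `Λ`, leaving `Λ r = A / L`; the price is the `ψ`
      -- inside `Q`.
      (Ω := Ω) (r := 1 / (L * ψ * (1 + Ω) ^ R)) (Λ := N * wbar * ψ * (c * (H * (1 + Ω) ^ R)))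
      (a := -(W / 2)) (W := W) (A := N * wbar * (c * H))
      (C := (4 * (wbar + 1) + 4 * (wbar * (c * H)) + 2 * (xbar + 1) + 8 * (c * H)) * N *
        (1 + Real.log ψ))
      (Q := ψ * L * Ω * m) (δ := δ) (R := R) hΩ (by positivity) (by positivity) hW0
      (by positivity) hR hd0 (by simpa using Nat.one_le_two_pow) (by linarith) hδ hδ1
      (covering_base_le hR (by linarith) hΩ (by linarith) hψQ)
      (le_of_eq (by field_simp)) ?_ (fun ω hω _ => (hmeas ω hω).1.neg) ?_ ?_
    · refine (measure_mono ?_).trans this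
      intro S hS hcon
      exact hS fun ω hω => hcon ω hω ()
    · rw [hW]
      have e1 : 0 ≤ N * (wbar * (c * H)) * Real.log ψ := by positivity
      have e2 : 0 ≤ (2 * (xbar + 1) + 8 * (c * H)) * N * (1 + Real.log ψ) := by positivity
      linarith
    · intro ω hω _ y hy
      have h2 := abs_le.1 (abs_logNSW_le hw hψ (hu ω hω y hy))
      have h3 : N * wbar * Real.log ψ ≤ W / 2 := by
        rw [hW]
        have e1 : 0 ≤ N * wbar + N * (1 + Real.log ψ) := by positivity
        linarith
      exact ⟨by linarith, by linarith⟩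
    · intro ω ω' hω hω' _ y hy
      rw [neg_sub_neg, abs_sub_comm]
      refine (abs_logNSW_sub_le hw hψ (fun i => (hu ω hω y hy i).1)
        (fun i => (hu ω' hω' y hy i).1) fun i => abs_utility_sub_le (hε ω ω')
          ((hV _ hy.1).1 i) ((hV _ hy.1).2 i) (hlip ω ω' hω hω' y hy i)).trans_eq ?_
      ring
  · have h1 : (L : ℝ) * Ω * m ≤ L * N * Ω * m := by
      have : (L : ℝ) * Ω * m ≤ N * (L * Ω * m) := le_mul_of_one_le_left (by positivity) hNr
      linarith
    refine measure_pi_uniform_genError_rate F hL hF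
      (fun (ω : MechParam A R K N M → ℝ) i => exploitability V D (mechanism A w ζ ω) i)
      (Ω := Ω) (r := 1 / (L * (1 + Ω) ^ R)) (Λ := 2 * (c * (H * (1 + Ω) ^ R)))
      (a := 0) (W := xbar + 1) (A := 2 * (c * H)) (R := R) hΩ (by positivity) (by positivity)
      (by positivity) (by positivity) hR hd0 ?_ (by linarith) hδ hδ1
      (covering_base_le hR (by linarith) hΩ (by linarith) (by linarith))
      (le_of_eq (by field_simp)) ?_ (fun ω hω => (hmeas ω hω).2) ?_ ?_
    · rw [Fintype.card_fin]
      exact hd.trans Nat.lt_two_pow_self.le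
    · have : 0 ≤ wbar * (c * H) := by positivity
      linarith
    · intro ω hω i y hy
      have h2 := exploitability_mem_Icc hV hD hxbar (hnn ω) i hy
      exact ⟨h2.1, by linarith [h2.2]⟩
    · intro ω ω' hω hω' i y hy
      refine (abs_exploitability_sub_le hV hD hxbar (hnn ω) (hnn ω') (hε ω ω')
        (hlip ω ω' hω hω') i hy).trans_eq ?_
      ring
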